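/- Let $K>0$ be fixed. For every $m\ge 1$ let $D_0=D_0^{(m)}\in\mathbb R^{m\times m}$ be a symmetric matrix, put $A_0=A_0^{(m)}=D_0^2$, and let $p=p_m\in[0,1]$. Write $\|A_0\|$ for the operator norm of $A_0$ with respect to the Euclidean norm, and suppose that, as $m\to\infty$, $$\log m\cdot\|A_0\| = o\bigl(p\,\mathrm{tr}(A_0)\bigr).$$ Then there is a deterministic sequence $\varepsilon_m\to 0$, depending only on $K$ and on the sequences $(D_0^{(m)})$ and $(p_m)$, such that the following holds for every $m\ge1$. Let $X=(X_1,\dots,X_m)$ be a random vector with independent components satisfying $\mathbb E X_i=0$, $\mathbb E X_i^2=1$ and $\|X_i\|_{\psi_2}:=\sup_{q\ge1}q^{-1/2}(\mathbb E|X_i|^q)^{1/q}\le K$. Let $\xi=(\xi_1,\dots,\xi_m)\in\{0,1\}^m$ be a random vector, independent of $X$, with independent components satisfying $\mathbb E\xi_i=p$, and let $D_\xi=\mathrm{diag}(\xi_1,\dots,\xi_m)$. Then $$\mathbb P\Bigl(\bigl|X^TD_0D_\xi D_0X-p\,\mathrm{tr}(A_0)\bigr|\le\varepsilon_m\,p\,\mathrm{tr}(A_0)\Bigr)\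 \ge\ 1-\frac4{m^4};$$ that is, with probability at least $1-4/m^4$, $X^TD_0D_\xi D_0X=p\,\mathrm{tr}(A_0)(1+o(1))$. -/

import Mathlib

open MeasureTheory ProbabilityTheory Filter Topology Asymptotics
open scoped ENNReal Matrix

noncomputable section

/-- The sub-gaussian (`ψ₂`) norm `sup_{q ≥ 1} q^{-1/2} (𝔼 |Z| ^ q)^{1/q}` of a real random
variable `Z`, as an extended nonnegative real (it is `∞` if `Z` is not sub-gaussian). -/
def psi2Norm {Ω : Type*} [MeasurableSpace Ω] (μ : Measure Ω) (Z : Ω → ℝ) : ℝ≥0∞ :=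
  ⨆ (q : ℝ) (_ : 1 ≤ q), eLpNorm Z (ENNReal.ofReal q) μ / ENNReal.ofReal (Real.sqrt q)

/-- The operator norm of a real square matrix with respect to the Euclidean norm. -/
def opNorm {m : ℕ} (A : Matrix (Fin m) (Fin m) ℝ) : ℝ :=
  ‖Matrix.toEuclideanCLM (n := Fin m) (𝕜 := ℝ) A‖

/-- The sparse quadratic form `xᵀ D D_z D x`, where `D_z = diag(z)`. -/
def sparseQuadForm {m : ℕ} (D : Matrix (Fin m) (Fin m) ℝ) (z x : Fin m → ℝ) : ℝ :=
  x ⬝ᵥ ((D * Matrix.diagonal z * D) *ᵥ x)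

end

/-! Write `N = ‖A₀‖`, `T = p tr A₀` and `A_ξ = D₀ D_ξ D₀`. With `ξ` frozen, `A_ξ` is positive
semidefinite and bounded by `A₀`, so a Hanson–Wright estimate gives `𝔼 exp(t(XᵀA_ξX - tr A_ξ)) ≤
exp(C t² N tr A_ξ)` for `|t| N` small (`lintegral_expE_quadForm_le`). The off-diagonal part is
handled by decoupling into disjoint blocks and linearizing with an auxiliary Gaussian vector; the
diagonal part is a sum of independent subexponential variables.

The bound depends on `ξ` only through `tr A_ξ = ∑ (A₀)ₖₖ ξₖ`, a sum of independent variables, so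
averaging over `ξ` yields `𝔼 exp(t(Q - T)) ≤ exp(C' t² N T)` for the sparse form `Q`
(`lintegral_expE_sparseQuadForm_le`). Chernoff's bound at `t = r/N` has exponent `(C' r² - r ε)
T/N`. The rate hypothesis says `η = N log m / T → 0`, and `ε = C' r + 4η/r` makes the exponent
exactly `-4 log m`; taking `r` of order `√η` sends `ε` to zero.

Exponential moments are taken as integrals in `ℝ≥0∞`, so that Tonelli and products need no
integrability side conditions. -/

/-! ### Exponential moments in `ℝ≥0∞` -/

/-- The exponential of a real number, as an extended nonnegative real. -/
noncomputable def expE (x : ℝ) : ℝ≥0∞ := ENNReal.ofReal (Real.exp x)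

lemma expE_add (x y : ℝ) : expE (x + y) = expE x * expE y := by
  rw [expE, Real.exp_add, ENNReal.ofReal_mul (Real.exp_pos x).le]; rfl

@[simp] lemma expE_zero : expE 0 = 1 := by simp [expE]

lemma expE_mono {x y : ℝ} (h : x ≤ y) : expE x ≤ expE y :=
  ENNReal.ofReal_le_ofReal (Real.exp_le_exp.2 h)

lemma expE_ne_zero (x : ℝ) : expE x ≠ 0 := by simp [expE, Real.exp_pos]

lemma expE_ne_top (x : ℝ) : expE x ≠ ∞ := ENNReal.ofReal_ne_top

lemma expE_sum {ι : Type*} (s : Finset ι) (f : ι → ℝ) :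
    expE (∑ i ∈ s, f i) = ∏ i ∈ s, expE (f i) := by
  rw [expE, Real.exp_sum, ENNReal.ofReal_prod_of_nonneg fun i _ => (Real.exp_pos _).le]; rfl

@[fun_prop] lemma measurable_expE : Measurable expE := by unfold expE; fun_prop

/-- AM-GM in place of independence: it separates the diagonal and off-diagonal parts of a quadratic
form, at the price of doubling the parameter. -/
lemma expE_add_le (x y : ℝ) : expE (x + y) ≤ 2⁻¹ * (expE (2 * x) + expE (2 * y)) := by
  have h : Real.exp (x + y) ≤ 2⁻¹ * (Real.exp (2 * x) + Real.exp (2 * y)) := by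
    rw [two_mul, two_mul, Real.exp_add, Real.exp_add, Real.exp_add]
    nlinarith [sq_nonneg (Real.exp x - Real.exp y)]
  refine (ENNReal.ofReal_le_ofReal h).trans_eq ?_
  rw [ENNReal.ofReal_mul (by norm_num), ENNReal.ofReal_add (Real.exp_pos _).le (Real.exp_pos _).le,
    ENNReal.ofReal_inv_of_pos (by norm_num)]
  simp [expE]

/-- Exponential moments of a sum of functions of independent variables factorize. -/
lemma lintegral_expE_sum {Ω : Type*} [MeasurableSpace Ω] {μ : Measure Ω}
    {ι : Type*} [Fintype ι] {X : ι → Ω → ℝ} (hX : ∀ i, Measurable (X i)) (hi : iIndepFun X μ)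
    (f : ι → ℝ → ℝ) (hf : ∀ i, Measurable (f i)) :
    ∫⁻ ω, expE (∑ i, f i (X i ω)) ∂μ = ∏ i, ∫⁻ ω, expE (f i (X i ω)) ∂μ := by
  simp_rw [expE_sum]
  exact lintegral_prod_eq_prod_lintegral_of_indepFun Finset.univ
    (fun i ω => expE (f i (X i ω)))
    (hi.comp (fun i x => expE (f i x)) fun i => by fun_prop) fun i => by fun_prop

lemma lintegral_expE_sum_le {Ω : Type*} [MeasurableSpace Ω] {μ : Measure Ω}
    {ι : Type*} [Fintype ι] {X : ι → Ω → ℝ} (hX : ∀ i, Measurable (X i)) (hi : iIndepFun X μ)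
    (f : ι → ℝ → ℝ) (hf : ∀ i, Measurable (f i)) (c : ι → ℝ)
    (h : ∀ i, ∫⁻ ω, expE (f i (X i ω)) ∂μ ≤ expE (c i)) :
    ∫⁻ ω, expE (∑ i, f i (X i ω)) ∂μ ≤ expE (∑ i, c i) := by
  rw [lintegral_expE_sum hX hi f hf, expE_sum]
  exact Finset.prod_le_prod' fun i _ => h i

/-! ### Gaussian exponential moments and linearization -/

lemma lintegral_expE_pi (m : ℕ) (f : Fin m → ℝ → ℝ) (hf : ∀ i, Measurable (f i)) :
    ∫⁻ g, expE (∑ i, f i (g i)) ∂(Measure.pi fun _ : Fin m => gaussianReal 0 1)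
      = ∏ i, ∫⁻ x, expE (f i x) ∂(gaussianReal 0 1) := by
  have hi : iIndepFun (fun (i : Fin m) (g : Fin m → ℝ) => g i)
      (Measure.pi fun _ : Fin m => gaussianReal 0 1) :=
    iIndepFun_pi (X := fun _ x => x) fun i => aemeasurable_id
  rw [lintegral_expE_sum (fun i => measurable_pi_apply i) hi f hf]
  refine Finset.prod_congr rfl fun i _ => ?_
  exact (measurePreserving_eval (fun _ : Fin m => gaussianReal 0 1) i).lintegral_comp
    (measurable_expE.comp (hf i))

lemma lintegral_expE_mul_gaussian (t : ℝ) :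
    ∫⁻ x, expE (t * x) ∂(gaussianReal 0 1) = expE (t ^ 2 / 2) := by
  have h := congrFun (mgf_id_gaussianReal (μ := 0) (v := 1)) t
  unfold expE
  rw [← ofReal_integral_eq_lintegral_ofReal (integrable_exp_mul_gaussianReal t)
    (ae_of_all _ fun x => (Real.exp_pos _).le)]
  simp only [mgf, id] at h
  rw [h]; simp

/-- The integral equals `(1 - 2x)^(-1/2)`; after squaring, the claim becomes `exp(-4x) ≤ 1 - 2x`,
which holds on `[0, 1/4]`. -/
lemma lintegral_expE_mul_sq_gaussian {x : ℝ} (h0 : 0 ≤ x) (hx : x ≤ 1 / 4) :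
    ∫⁻ g, expE (x * g ^ 2) ∂(gaussianReal 0 1) ≤ expE (2 * x) := by
  have hb : 0 < 1 / 2 - x := by linarith
  rw [gaussianReal_of_var_ne_zero _ one_ne_zero,
    lintegral_withDensity_eq_lintegral_mul _ (by fun_prop) (by fun_prop)]
  have h1 : ∀ g : ℝ, (gaussianPDF 0 1 * fun g => expE (x * g ^ 2)) g
      = ENNReal.ofReal ((√(2 * Real.pi))⁻¹ * Real.exp (-(1 / 2 - x) * g ^ 2)) := by
    intro g
    simp only [Pi.mul_apply, gaussianPDF, gaussianPDFReal, expE]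
    rw [← ENNReal.ofReal_mul (by positivity), mul_assoc, ← Real.exp_add]
    congr 3
    · simp
    · simp; ring
  simp_rw [h1]
  rw [← ofReal_integral_eq_lintegral_ofReal ((integrable_exp_neg_mul_sq hb).const_mul _)
    (ae_of_all _ fun x => by positivity), integral_const_mul, integral_gaussian, expE]
  apply ENNReal.ofReal_le_ofReal
  rw [← Real.sqrt_inv, ← Real.sqrt_mul (by positivity)]
  apply Real.sqrt_le_iff.2 ⟨(Real.exp_pos _).le, ?_⟩
  rw [← Real.exp_nat_mul]
  have h2 : (2 * Real.pi)⁻¹ * (Real.pi / (1 / 2 - x)) = (1 - 2 * x)⁻¹ := by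
    have := Real.pi_pos.ne'
    have h3 : 1 - 2 * x ≠ 0 := by linarith
    have h4 : 1 / 2 - x ≠ 0 := hb.ne'
    field_simp
  rw [h2]
  have h3 : Real.exp (-(4 * x)) ≤ 1 - 2 * x := by
    have h6 : 1 + 4 * x + (4 * x) ^ 2 / 2 ≤ Real.exp (4 * x) :=
      Real.quadratic_le_exp_of_nonneg (by linarith)
    rw [Real.exp_neg]
    apply inv_le_of_inv_le₀ (by linarith)
    refine le_trans ?_ h6
    rw [inv_le_iff_one_le_mul₀ (by linarith)]
    nlinarith [mul_nonneg h0 (sub_nonneg.2 hx), mul_nonneg h0 (mul_nonneg h0 (sub_nonneg.2 hx))]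
  rw [Real.exp_neg] at h3
  push_cast
  rw [show (2 : ℝ) * (2 * x) = 4 * x by ring]
  exact inv_le_of_inv_le₀ (Real.exp_pos _) h3

/-- A random vector whose linear functionals have exponential moments dominated by those of a
centred Gaussian vector with covariance `2 s • 1`. -/
def IsSubgaussianVector {Ω : Type*} [MeasurableSpace Ω] (μ : Measure Ω) {m : ℕ}
    (V : Ω → Fin m → ℝ) (s : ℝ) : Prop :=
  ∀ v : Fin m → ℝ, ∫⁻ ω, expE (v ⬝ᵥ V ω) ∂μ ≤ expE (s * (v ⬝ᵥ v))

/-- Exponential moments of a diagonalized positive quadratic form of a subgaussian vector,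
by linearization with an auxiliary Gaussian vector. -/
lemma IsSubgaussianVector.lintegral_expE_sum_sq_le {Ω : Type*} [MeasurableSpace Ω] {μ : Measure Ω}
    [IsProbabilityMeasure μ] {m : ℕ} {V : Ω → Fin m → ℝ} {s : ℝ} (hV : Measurable V)
    (h : IsSubgaussianVector μ V s) (hs : 0 ≤ s) {b : Fin m → Fin m → ℝ}
    (hb : ∀ k l, b k ⬝ᵥ b l = if k = l then 1 else 0) {w : Fin m → ℝ} (hw : ∀ k, 0 ≤ w k)
    (hw' : ∀ k, s * w k ≤ 1 / 8) :
    ∫⁻ ω, expE (∑ k, w k * (b k ⬝ᵥ V ω) ^ 2) ∂μ ≤ expE (4 * s * ∑ k, w k) := by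
  set G := Measure.pi fun _ : Fin m => gaussianReal 0 1
  let c : (Fin m → ℝ) → Fin m → ℝ := fun g => ∑ k, (√(2 * w k) * g k) • b k
  have hc : ∀ g v, c g ⬝ᵥ v = ∑ k, √(2 * w k) * (b k ⬝ᵥ v) * g k := by
    intro g v
    simp only [c, sum_dotProduct, smul_dotProduct, smul_eq_mul]
    exact Finset.sum_congr rfl fun k _ => by ring
  have hcc : ∀ g, c g ⬝ᵥ c g = ∑ k, 2 * w k * g k ^ 2 := by
    intro g
    rw [hc]
    refine Finset.sum_congr rfl fun k _ => ?_
    have : b k ⬝ᵥ c g = √(2 * w k) * g k := by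
      simp [c, dotProduct_sum, dotProduct_smul, hb]
    rw [this]
    have := Real.mul_self_sqrt (show 0 ≤ 2 * w k by linarith [hw k])
    linear_combination g k ^ 2 * this
  have hcm : Measurable c := by fun_prop
  -- For a standard Gaussian `g`, `𝔼 exp(√(2w) y g) = exp(w y²)`: each square becomes an average of
  -- exponentials linear in `V`. After exchanging the integrals, the subgaussian hypothesis applies
  -- for each fixed `g`.
  have h1 : ∀ ω, expE (∑ k, w k * (b k ⬝ᵥ V ω) ^ 2) = ∫⁻ g, expE (c g ⬝ᵥ V ω) ∂G := by
    intro ω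
    simp_rw [hc]
    rw [lintegral_expE_pi m (fun k x => √(2 * w k) * (b k ⬝ᵥ V ω) * x) (fun k => by fun_prop),
      expE_sum]
    refine Finset.prod_congr rfl fun k _ => ?_
    rw [lintegral_expE_mul_gaussian, mul_pow, Real.sq_sqrt (by linarith [hw k])]
    congr 1; ring
  simp_rw [h1]
  rw [lintegral_lintegral_swap (by
    apply Measurable.aemeasurable
    simp only [Function.uncurry_def, dotProduct]
    fun_prop)]
  calc ∫⁻ g, ∫⁻ ω, expE (c g ⬝ᵥ V ω) ∂μ ∂G
      ≤ ∫⁻ g, expE (∑ k, 2 * s * w k * g k ^ 2) ∂G := by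
        refine lintegral_mono fun g => (h (c g)).trans_eq ?_
        rw [hcc, Finset.mul_sum]
        congr 1
        exact Finset.sum_congr rfl fun k _ => by ring
    _ = ∏ k, ∫⁻ x, expE (2 * s * w k * x ^ 2) ∂(gaussianReal 0 1) :=
        lintegral_expE_pi m (fun k x => 2 * s * w k * x ^ 2) (fun k => by fun_prop)
    _ ≤ ∏ k, expE (2 * (2 * s * w k)) := Finset.prod_le_prod' fun k _ =>
        lintegral_expE_mul_sq_gaussian (by have := mul_nonneg hs (hw k); linarith)
          (by linarith [hw' k])
    _ = expE (4 * s * ∑ k, w k) := by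
        rw [← expE_sum, Finset.mul_sum]
        congr 1
        exact Finset.sum_congr rfl fun k _ => by ring

lemma ProbabilityTheory.IndepFun.lintegral_eq_lintegral_lintegral {Ω E F : Type*}
    [MeasurableSpace Ω] [MeasurableSpace E] [MeasurableSpace F] {μ : Measure Ω}
    [IsProbabilityMeasure μ] {U : Ω → E} {V : Ω → F} (h : IndepFun U V μ) (hU : Measurable U)
    (hV : Measurable V) {f : E × F → ℝ≥0∞} (hf : Measurable f) :
    ∫⁻ ω, f (U ω, V ω) ∂μ = ∫⁻ ω', ∫⁻ ω, f (U ω, V ω') ∂μ ∂μ := by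
  have hPU : IsProbabilityMeasure (μ.map U) := Measure.isProbabilityMeasure_map hU.aemeasurable
  have hPV : IsProbabilityMeasure (μ.map V) := Measure.isProbabilityMeasure_map hV.aemeasurable
  rw [← lintegral_map hf (hU.prodMk hV),
    (indepFun_iff_map_prod_eq_prod_map_map hU.aemeasurable hV.aemeasurable).1 h,
    lintegral_prod_symm _ hf.aemeasurable, lintegral_map hf.lintegral_prod_left' hV]
  refine lintegral_congr fun ω' => ?_
  exact lintegral_map (f := fun x => f (x, V ω')) (hf.comp (measurable_id.prodMk measurable_const)) hU

/-! ### Bilinear forms in disjoint blocks of variables -/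

/-- The vector `x` with the coordinates outside `I` set to zero. -/
def restrictTo {m : ℕ} (I : Finset (Fin m)) (x : Fin m → ℝ) : Fin m → ℝ :=
  fun i => if i ∈ I then x i else 0

lemma measurable_restrictTo {m : ℕ} (I : Finset (Fin m)) : Measurable (restrictTo I) := by
  refine measurable_pi_lambda _ fun i => ?_
  by_cases h : i ∈ I <;> simp only [restrictTo, h, if_true, if_false] <;> fun_prop

lemma isSubgaussianVector_restrictTo {Ω : Type*} [MeasurableSpace Ω] {μ : Measure Ω}
    {m : ℕ} {X : Fin m → Ω → ℝ} (hX : ∀ i, Measurable (X i)) (hi : iIndepFun X μ)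
    {s : ℝ} (hs : 0 ≤ s) (h : ∀ i t, ∫⁻ ω, expE (t * X i ω) ∂μ ≤ expE (s * t ^ 2))
    (I : Finset (Fin m)) :
    IsSubgaussianVector μ (fun ω => restrictTo I fun i => X i ω) s := by
  intro v
  have h1 : ∀ ω, v ⬝ᵥ restrictTo I (fun i => X i ω)
      = ∑ i, (if i ∈ I then v i else 0) * X i ω := by
    intro ω
    refine Finset.sum_congr rfl fun i _ => ?_
    by_cases hiI : i ∈ I <;> simp [restrictTo, hiI]
  simp_rw [h1]
  refine (lintegral_expE_sum_le hX hi (fun i x => (if i ∈ I then v i else 0) * x)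
    (fun i => by fun_prop) _ fun i => h i _).trans (expE_mono ?_)
  rw [dotProduct, Finset.mul_sum]
  refine Finset.sum_le_sum fun i _ => mul_le_mul_of_nonneg_left ?_ hs
  split_ifs
  · rw [sq]
  · simpa using mul_self_nonneg (v i)

lemma indepFun_restrictTo {Ω : Type*} [MeasurableSpace Ω] {μ : Measure Ω}
    {m : ℕ} {X : Fin m → Ω → ℝ} (hX : ∀ i, Measurable (X i)) (hi : iIndepFun X μ)
    (I : Finset (Fin m)) :
    IndepFun (fun ω => restrictTo I fun i => X i ω) (fun ω => restrictTo Iᶜ fun i => X i ω) μ := by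
  have key : ∀ J : Finset (Fin m), ∃ φ : (J → ℝ) → Fin m → ℝ, Measurable φ ∧
      (fun ω => restrictTo J fun i => X i ω) = φ ∘ fun ω (i : J) => X i ω := by
    intro J
    refine ⟨fun y i => if h : i ∈ J then y ⟨i, h⟩ else 0, ?_, ?_⟩
    · refine measurable_pi_lambda _ fun i => ?_
      by_cases h : i ∈ J <;> simp only [h, dite_true, dite_false] <;> fun_prop
    · funext ω i
      by_cases h : i ∈ J <;> simp [restrictTo, h]
  obtain ⟨φ, hφ, e1⟩ := key I
  obtain ⟨ψ, hψ, e2⟩ := key Iᶜ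
  rw [e1, e2]
  exact (hi.indepFun_finset I Iᶜ disjoint_compl_right hX).comp hφ hψ

/-- A symmetric matrix has an orthonormal basis of eigenvectors. -/
lemma exists_eigenbasis {m : ℕ} {A : Matrix (Fin m) (Fin m) ℝ} (hA : A.IsSymm) :
    ∃ (b : Fin m → Fin m → ℝ) (a : Fin m → ℝ),
      (∀ k l, b k ⬝ᵥ b l = if k = l then 1 else 0) ∧ (∀ k, A *ᵥ b k = a k • b k) ∧
      (∀ v, v ⬝ᵥ v = ∑ k, (b k ⬝ᵥ v) ^ 2) ∧ A.trace = ∑ k, a k := by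
  have hH : A.IsHermitian := by
    rw [Matrix.IsHermitian, Matrix.conjTranspose_eq_transpose_of_trivial]; exact hA
  have hin : ∀ x y : EuclideanSpace ℝ (Fin m), inner ℝ x y = x.ofLp ⬝ᵥ y.ofLp := by
    intro x y
    rw [EuclideanSpace.inner_eq_star_dotProduct, dotProduct_comm]; simp
  refine ⟨fun k => (hH.eigenvectorBasis k).ofLp, hH.eigenvalues, fun k l => ?_,
    fun k => hH.mulVec_eigenvectorBasis k, fun v => ?_, by simpa using hH.trace_eq_sum_eigenvalues⟩
  · rw [← hin]
    exact orthonormal_iff_ite.1 hH.eigenvectorBasis.orthonormal k l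
  · have h := hH.eigenvectorBasis.sum_sq_inner_right (WithLp.toLp 2 v)
    simp_rw [hin] at h
    rw [h, ← real_inner_self_eq_norm_sq, hin]

/-- Exponential moments of a decoupled bilinear form of independent subgaussian variables. -/
lemma lintegral_expE_bilin_restrictTo_le {Ω : Type*} [MeasurableSpace Ω] {μ : Measure Ω}
    [IsProbabilityMeasure μ] {m : ℕ} {X : Fin m → Ω → ℝ} (hX : ∀ i, Measurable (X i))
    (hi : iIndepFun X μ) {s : ℝ} (hs : 0 ≤ s)
    (h : ∀ i t, ∫⁻ ω, expE (t * X i ω) ∂μ ≤ expE (s * t ^ 2))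
    {A : Matrix (Fin m) (Fin m) ℝ} (hA : A.IsSymm) {N : ℝ}
    (hpos : ∀ x, 0 ≤ x ⬝ᵥ (A *ᵥ x)) (hN : ∀ x, x ⬝ᵥ (A *ᵥ x) ≤ N * (x ⬝ᵥ x))
    {t : ℝ} (ht : s ^ 2 * t ^ 2 * N ^ 2 ≤ 1 / 8) (I : Finset (Fin m)) :
    ∫⁻ ω, expE (t * (restrictTo I (fun i => X i ω) ⬝ᵥ (A *ᵥ restrictTo Iᶜ fun i => X i ω))) ∂μ
      ≤ expE (4 * s ^ 2 * t ^ 2 * (N * A.trace)) := by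
  obtain ⟨b, a, hb, hab, hv, htr⟩ := exists_eigenbasis hA
  have ha : ∀ k, b k ⬝ᵥ (A *ᵥ b k) = a k := fun k => by simp [hab, hb]
  have ha0 : ∀ k, 0 ≤ a k := fun k => ha k ▸ hpos (b k)
  have haN : ∀ k, a k ≤ N := fun k => by simpa [ha, hb] using hN (b k)
  have hAv : ∀ v, (A *ᵥ v) ⬝ᵥ (A *ᵥ v) = ∑ k, a k ^ 2 * (b k ⬝ᵥ v) ^ 2 := by
    intro v
    rw [hv]
    refine Finset.sum_congr rfl fun k _ => ?_
    rw [Matrix.dotProduct_mulVec, ← Matrix.mulVec_transpose, hA.eq, hab, smul_dotProduct,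
      smul_eq_mul, mul_pow]
  have hXm : Measurable fun ω i => X i ω := measurable_pi_lambda _ hX
  set U := fun ω => restrictTo I fun i => X i ω
  set V := fun ω => restrictTo Iᶜ fun i => X i ω
  have hUm : Measurable U := (measurable_restrictTo I).comp hXm
  have hVm : Measurable V := (measurable_restrictTo Iᶜ).comp hXm
  have hUs := isSubgaussianVector_restrictTo hX hi hs h I
  have hVs := isSubgaussianVector_restrictTo hX hi hs h Iᶜ
  have hF : Measurable fun q : (Fin m → ℝ) × (Fin m → ℝ) =>
      expE (t * (q.1 ⬝ᵥ (A *ᵥ q.2))) := by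
    simp only [dotProduct, Matrix.mulVec]; fun_prop
  calc ∫⁻ ω, expE (t * (U ω ⬝ᵥ (A *ᵥ V ω))) ∂μ
      = ∫⁻ ω', ∫⁻ ω, expE (t * (U ω ⬝ᵥ (A *ᵥ V ω'))) ∂μ ∂μ :=
        (indepFun_restrictTo hX hi I).lintegral_eq_lintegral_lintegral hUm hVm hF
    -- With `V` frozen the form is linear in `U`, with coefficient vector `t A V`; its squared
    -- length, in the eigenbasis, is a diagonal quadratic form in `V`.
    _ ≤ ∫⁻ ω', expE (∑ k, (s * t ^ 2 * a k ^ 2) * (b k ⬝ᵥ V ω') ^ 2) ∂μ := by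
        refine lintegral_mono fun ω' => ?_
        refine le_trans (le_of_eq ?_) ((hUs (t • (A *ᵥ V ω'))).trans_eq ?_)
        · refine lintegral_congr fun ω => ?_
          rw [smul_dotProduct, smul_eq_mul, dotProduct_comm]
        · simp only [smul_dotProduct, dotProduct_smul, smul_eq_mul, hAv, Finset.mul_sum]
          congr 1
          exact Finset.sum_congr rfl fun k _ => by ring
    _ ≤ expE (4 * s * ∑ k, s * t ^ 2 * a k ^ 2) := by
        refine hVs.lintegral_expE_sum_sq_le hVm hs hb (fun k => by positivity) fun k => ?_
        refine le_trans ?_ ht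
        have : a k ^ 2 ≤ N ^ 2 := pow_le_pow_left₀ (ha0 k) (haN k) 2
        nlinarith [mul_le_mul_of_nonneg_left this (show 0 ≤ s ^ 2 * t ^ 2 by positivity)]
    _ ≤ expE (4 * s ^ 2 * t ^ 2 * (N * A.trace)) := by
        apply expE_mono
        rw [htr, ← Finset.mul_sum]
        have : ∑ k, a k ^ 2 ≤ N * ∑ k, a k := by
          rw [Finset.mul_sum]
          exact Finset.sum_le_sum fun k _ => by nlinarith [ha0 k, haN k]
        nlinarith [mul_le_mul_of_nonneg_left this (show 0 ≤ 4 * s ^ 2 * t ^ 2 by positivity)]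

/-! ### Decoupling -/

/-- Toggling membership of `i` and of `j` groups the subsets into fours, and exactly one of each
four contains `i` but not `j`. -/
lemma sum_indicator_mem_notMem {m : ℕ} {i j : Fin m} (hij : i ≠ j) :
    ∑ I : Finset (Fin m), (if i ∈ I then (1 : ℝ) else 0) * (if j ∈ Iᶜ then 1 else 0)
      = 2 ^ m / 4 := by
  have hflip : ∀ (k : Fin m) (f : Finset (Fin m) → ℝ),
      ∑ I, f (symmDiff I {k}) = ∑ I, f I := fun k f =>
    Equiv.sum_comp (Function.Involutive.toPerm (fun I : Finset (Fin m) => symmDiff I {k})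
      fun I => symmDiff_symmDiff_cancel_right _ _) f
  set f : Finset (Fin m) → ℝ :=
    fun I => (if i ∈ I then (1 : ℝ) else 0) * (if j ∈ Iᶜ then 1 else 0) with hf
  have h1 := hflip i f
  have h2 := hflip j f
  have h3 := (hflip j fun I => f (symmDiff I {i})).trans h1
  have h4 : ∑ I, (f I + f (symmDiff I {i}) + f (symmDiff I {j})
      + f (symmDiff (symmDiff I {j}) {i})) = ∑ I : Finset (Fin m), (1 : ℝ) := by
    refine Finset.sum_congr rfl fun I _ => ?_
    have hji := hij.symm
    by_cases ha : i ∈ I <;> by_cases hb : j ∈ I <;>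
      simp [hf, Finset.mem_symmDiff, ha, hb, hij, hji]
  simp only [Finset.sum_add_distrib] at h4
  rw [h1, h2, h3] at h4
  simp at h4
  linarith

/-- Decoupling: the off-diagonal part of a quadratic form is an average of bilinear forms in
disjoint blocks of variables. -/
lemma sum_bilin_restrictTo {m : ℕ} (A : Matrix (Fin m) (Fin m) ℝ) (x : Fin m → ℝ) :
    ∑ I : Finset (Fin m), restrictTo I x ⬝ᵥ (A *ᵥ restrictTo Iᶜ x)
      = 2 ^ m / 4 * (x ⬝ᵥ (A *ᵥ x) - ∑ i, A i i * x i ^ 2) := by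
  have h1 : ∀ I : Finset (Fin m), restrictTo I x ⬝ᵥ (A *ᵥ restrictTo Iᶜ x)
      = ∑ i, ∑ j, A i j * x i * x j *
          ((if i ∈ I then (1 : ℝ) else 0) * (if j ∈ Iᶜ then 1 else 0)) := by
    intro I
    simp only [dotProduct, Matrix.mulVec, Finset.mul_sum, restrictTo]
    refine Finset.sum_congr rfl fun i _ => Finset.sum_congr rfl fun j _ => ?_
    split_ifs <;> ring
  have h2 : x ⬝ᵥ (A *ᵥ x) - ∑ i, A i i * x i ^ 2
      = ∑ i, ∑ j, if i = j then 0 else A i j * x i * x j := by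
    simp only [dotProduct, Matrix.mulVec, Finset.mul_sum]
    rw [← Finset.sum_sub_distrib]
    refine Finset.sum_congr rfl fun i _ => ?_
    have : ∀ j, (if i = j then 0 else A i j * x i * x j)
        = x i * (A i j * x j) - if i = j then A i j * x i * x j else 0 := by
      intro j; split_ifs <;> ring
    simp_rw [this]
    rw [Finset.sum_sub_distrib, Finset.sum_ite_eq]
    simp; ring
  simp_rw [h1]
  rw [h2, Finset.mul_sum, Finset.sum_comm]
  refine Finset.sum_congr rfl fun i _ => ?_
  rw [Finset.mul_sum, Finset.sum_comm]
  refine Finset.sum_congr rfl fun j _ => ?_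
  rw [← Finset.mul_sum]
  by_cases hij : i = j
  · subst hij
    simp
    right
    refine Finset.sum_eq_zero fun I _ => ?_
    by_cases h : i ∈ I <;> simp [h]
  · rw [sum_indicator_mem_notMem hij, if_neg hij]; ring

/-- Jensen's inequality for a uniformly random subset `I`; the factor `4` is the inverse of the
probability that `i ∈ I` and `j ∉ I`. -/
lemma expE_offDiag_le {m : ℕ} (A : Matrix (Fin m) (Fin m) ℝ) (x : Fin m → ℝ) (t : ℝ) :
    expE (t * (x ⬝ᵥ (A *ᵥ x) - ∑ i, A i i * x i ^ 2))
      ≤ ENNReal.ofReal (2 ^ m)⁻¹ *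
        ∑ I : Finset (Fin m), expE (4 * t * (restrictTo I x ⬝ᵥ (A *ᵥ restrictTo Iᶜ x))) := by
  have h := convexOn_exp.map_sum_le (t := Finset.univ) (w := fun _ : Finset (Fin m) => (2 ^ m : ℝ)⁻¹)
    (p := fun I => 4 * t * (restrictTo I x ⬝ᵥ (A *ᵥ restrictTo Iᶜ x)))
    (fun _ _ => by positivity) (by simp) (fun _ _ => Set.mem_univ _)
  simp only [smul_eq_mul] at h
  rw [← Finset.mul_sum, ← Finset.mul_sum, ← Finset.mul_sum, sum_bilin_restrictTo] at h
  have e : (2 ^ m : ℝ)⁻¹ * (4 * t * (2 ^ m / 4 * (x ⬝ᵥ (A *ᵥ x) - ∑ i, A i i * x i ^ 2)))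
      = t * (x ⬝ᵥ (A *ᵥ x) - ∑ i, A i i * x i ^ 2) := by
    have : (2 ^ m : ℝ) ≠ 0 := by positivity
    field_simp
  rw [e] at h
  refine (ENNReal.ofReal_le_ofReal h).trans_eq ?_
  rw [ENNReal.ofReal_mul (by positivity), ENNReal.ofReal_sum_of_nonneg fun _ _ => (Real.exp_pos _).le]
  rfl

/-- Exponential moments of the off-diagonal part of a quadratic form. -/
lemma lintegral_expE_offDiag_le {Ω : Type*} [MeasurableSpace Ω] {μ : Measure Ω}
    [IsProbabilityMeasure μ] {m : ℕ} {X : Fin m → Ω → ℝ} (hX : ∀ i, Measurable (X i))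
    (hi : iIndepFun X μ) {s : ℝ} (hs : 0 ≤ s)
    (h : ∀ i t, ∫⁻ ω, expE (t * X i ω) ∂μ ≤ expE (s * t ^ 2))
    {A : Matrix (Fin m) (Fin m) ℝ} (hA : A.IsSymm) {N : ℝ}
    (hpos : ∀ x, 0 ≤ x ⬝ᵥ (A *ᵥ x)) (hN : ∀ x, x ⬝ᵥ (A *ᵥ x) ≤ N * (x ⬝ᵥ x))
    {t : ℝ} (ht : s ^ 2 * (4 * t) ^ 2 * N ^ 2 ≤ 1 / 8) :
    ∫⁻ ω, expE (t * ((fun i => X i ω) ⬝ᵥ (A *ᵥ fun i => X i ω) - ∑ i, A i i * X i ω ^ 2)) ∂μ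
      ≤ expE (64 * s ^ 2 * t ^ 2 * (N * A.trace)) := by
  have hXm : Measurable fun ω i => X i ω := measurable_pi_lambda _ hX
  have hm : ∀ I : Finset (Fin m), Measurable fun ω => expE (4 * t *
      (restrictTo I (fun i => X i ω) ⬝ᵥ (A *ᵥ restrictTo Iᶜ fun i => X i ω))) := by
    intro I
    have h1 := (measurable_restrictTo I).comp hXm
    have h2 := (measurable_restrictTo Iᶜ).comp hXm
    simp only [Function.comp_def, measurable_pi_iff] at h1 h2
    simp only [dotProduct, Matrix.mulVec]
    fun_prop
  refine (lintegral_mono fun ω => expE_offDiag_le A (fun i => X i ω) t).trans ?_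
  rw [lintegral_const_mul _ (Finset.measurable_sum _ fun I _ => hm I),
    lintegral_finsetSum _ fun I _ => hm I]
  refine (mul_le_mul_right (Finset.sum_le_sum fun I _ =>
    lintegral_expE_bilin_restrictTo_le hX hi hs h hA hpos hN ht I) _).trans_eq ?_
  rw [Finset.sum_const, nsmul_eq_mul, ← mul_assoc]
  have : ENNReal.ofReal (2 ^ m)⁻¹ * ((Finset.univ : Finset (Finset (Fin m))).card : ℝ≥0∞) = 1 := by
    rw [← ENNReal.ofReal_natCast, ← ENNReal.ofReal_mul (by positivity)]
    simp
  rw [this, one_mul]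
  congr 1; ring

/-! ### Scalar estimates: from `ψ₂` norms to exponential moments -/

lemma lintegral_expE_le_of_le {Ω : Type*} [MeasurableSpace Ω] {μ : Measure Ω} {f h : Ω → ℝ}
    {a : ℝ} (hle : ∀ ω, Real.exp (f ω) ≤ h ω) (hh : Integrable h μ) (ha : ∫ ω, h ω ∂μ ≤ Real.exp a) :
    ∫⁻ ω, expE (f ω) ∂μ ≤ expE a := by
  refine (lintegral_mono fun ω => ENNReal.ofReal_le_ofReal (hle ω)).trans ?_
  rw [← ofReal_integral_eq_lintegral_ofReal hh
    (ae_of_all _ fun ω => (Real.exp_pos _).le.trans (hle ω))]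
  exact ENNReal.ofReal_le_ofReal ha

lemma lintegral_pow_le_of_psi2Norm_le {Ω : Type*} [MeasurableSpace Ω] {μ : Measure Ω} {Z : Ω → ℝ}
    {K : ℝ} (hK : 0 ≤ K) (h : psi2Norm μ Z ≤ ENNReal.ofReal K) {k : ℕ} (hk : 1 ≤ k) :
    ∫⁻ ω, ENNReal.ofReal (Z ω ^ (2 * k)) ∂μ ≤ ENNReal.ofReal ((K ^ 2 * (2 * k)) ^ k) := by
  have hk' : (1 : ℝ) ≤ k := by exact_mod_cast hk
  have h1 : eLpNorm Z (ENNReal.ofReal (2 * k)) μ / ENNReal.ofReal (√(2 * k)) ≤ ENNReal.ofReal K :=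
    (le_iSup₂ (f := fun (q : ℝ) (_ : 1 ≤ q) =>
      eLpNorm Z (ENNReal.ofReal q) μ / ENNReal.ofReal (√q)) (2 * k : ℝ) (by linarith)).trans h
  have hq : 0 < √(2 * k : ℝ) := Real.sqrt_pos.2 (by linarith)
  rw [ENNReal.div_le_iff (by simpa using hq) ENNReal.ofReal_ne_top, ← ENNReal.ofReal_mul hK] at h1
  have h2 := eLpNorm_nnreal_pow_eq_lintegral (μ := μ) (f := Z) (p := ((2 * k : ℕ) : NNReal))
    (by simp; omega)
  have h3 : (((2 * k : ℕ) : NNReal) : ℝ≥0∞) = ENNReal.ofReal (2 * k) := by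
    rw [show (2 * k : ℝ) = ((2 * k : ℕ) : ℝ) by push_cast; rfl, ENNReal.ofReal_natCast]; simp
  rw [h3] at h2
  simp only [NNReal.coe_natCast, ENNReal.rpow_natCast] at h2
  calc ∫⁻ ω, ENNReal.ofReal (Z ω ^ (2 * k)) ∂μ
      = ∫⁻ ω, ‖Z ω‖ₑ ^ (2 * k) ∂μ := by
        refine lintegral_congr fun ω => ?_
        rw [Real.enorm_eq_ofReal_abs, ← ENNReal.ofReal_pow (abs_nonneg _),
          (even_two_mul k).pow_abs]
    _ ≤ ENNReal.ofReal (K * √(2 * k)) ^ (2 * k) := by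
        rw [← h2]; exact pow_le_pow_left' h1 _
    _ = ENNReal.ofReal ((K ^ 2 * (2 * k)) ^ k) := by
        rw [← ENNReal.ofReal_pow (by positivity), pow_mul, mul_pow, Real.sq_sqrt (by linarith)]

/-- A bound on the `ψ₂` norm gives a square-exponential moment. -/
lemma lintegral_expE_sq_le_of_psi2Norm_le {Ω : Type*} [MeasurableSpace Ω] {μ : Measure Ω}
    [IsProbabilityMeasure μ] {Z : Ω → ℝ} (hZ : Measurable Z) {K : ℝ} (hK : 0 < K)
    (h : psi2Norm μ Z ≤ ENNReal.ofReal K) :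
    ∫⁻ ω, expE ((4 * Real.exp 1 * K ^ 2)⁻¹ * Z ω ^ 2) ∂μ ≤ ENNReal.ofReal 2 := by
  -- Since `k^k / k! ≤ e^k`, the `k`-th term of the exponential series has expectation at most `(2 e
  -- c K²)^k`. This `c` makes the ratio `1/2`, so the sum is at most `2`.
  set c := (4 * Real.exp 1 * K ^ 2)⁻¹ with hc
  have hc0 : 0 < c := by positivity
  have hexp : ∀ ω, expE (c * Z ω ^ 2)
      = ∑' k : ℕ, ENNReal.ofReal (c ^ k / k.factorial) * ENNReal.ofReal (Z ω ^ (2 * k)) := by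
    intro ω
    rw [expE, Real.exp_eq_exp_ℝ, NormedSpace.exp_eq_tsum_div,
      ENNReal.ofReal_tsum_of_nonneg (fun n => by positivity) (Real.summable_pow_div_factorial _)]
    refine tsum_congr fun k => ?_
    rw [← ENNReal.ofReal_mul (by positivity), mul_pow, ← pow_mul]
    congr 1; ring
  simp_rw [hexp]
  rw [lintegral_tsum fun k => by fun_prop, ← tsum_geometric_two,
    ENNReal.ofReal_tsum_of_nonneg (fun n => by positivity) summable_geometric_two]
  refine ENNReal.tsum_le_tsum fun k => ?_
  rw [lintegral_const_mul _ (by fun_prop)]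
  rcases Nat.eq_zero_or_pos k with rfl | hk
  · simp
  refine (mul_le_mul_right (lintegral_pow_le_of_psi2Norm_le hK.le h hk) _).trans ?_
  rw [← ENNReal.ofReal_mul (by positivity)]
  apply ENNReal.ofReal_le_ofReal
  have h1 := Real.pow_div_factorial_le_exp (x := k) (by positivity) k
  have h2 : Real.exp k = Real.exp 1 ^ k := by rw [← Real.exp_nat_mul, mul_one]
  calc c ^ k / k.factorial * (K ^ 2 * (2 * k)) ^ k
      = (2 * c * K ^ 2) ^ k * ((k : ℝ) ^ k / k.factorial) := by rw [mul_pow, mul_pow, mul_pow, mul_pow]; ring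
    _ ≤ (2 * c * K ^ 2) ^ k * Real.exp 1 ^ k := by rw [← h2]; gcongr
    _ = (1 / 2) ^ k := by
        rw [← mul_pow]
        congr 1
        rw [hc]
        field_simp
        norm_num

lemma integrable_exp_of_lintegral_expE_le {Ω : Type*} [MeasurableSpace Ω] {μ : Measure Ω}
    {f : Ω → ℝ} (hf : Measurable f) {B : ℝ} (hB : 0 ≤ B)
    (h : ∫⁻ ω, expE (f ω) ∂μ ≤ ENNReal.ofReal B) :
    Integrable (fun ω => Real.exp (f ω)) μ ∧ ∫ ω, Real.exp (f ω) ∂μ ≤ B := by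
  have hi : Integrable (fun ω => Real.exp (f ω)) μ := by
    refine ⟨by fun_prop, ?_⟩
    rw [hasFiniteIntegral_iff_ofReal (ae_of_all _ fun ω => (Real.exp_pos _).le)]
    exact h.trans_lt ENNReal.ofReal_lt_top
  refine ⟨hi, ?_⟩
  have h2 := ofReal_integral_eq_lintegral_ofReal hi (ae_of_all _ fun ω => (Real.exp_pos _).le)
  rw [← ENNReal.ofReal_le_ofReal_iff hB, h2]
  exact h

/-- The linear term is kept bare so that it integrates to zero for a centred variable. -/
lemma exp_le_self_add_exp_sq (x : ℝ) : Real.exp x ≤ x + Real.exp (x ^ 2) := by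
  have h1 := Real.add_one_le_exp (x ^ 2)
  rcases le_or_gt |x| 1 with h | h
  · have := (abs_le.1 (Real.abs_exp_sub_one_sub_id_le h)).2
    linarith
  · rcases lt_abs.1 h with h | h
    · have : Real.exp x ≤ Real.exp (x ^ 2) := Real.exp_le_exp.2 (by nlinarith)
      linarith
    · have : Real.exp x ≤ 1 := Real.exp_le_one_iff.2 (by linarith)
      nlinarith

lemma exp_le_one_add_add_sq_mul_exp_abs (x : ℝ) :
    Real.exp x ≤ 1 + x + x ^ 2 * Real.exp |x| := by
  have h0 : 1 ≤ Real.exp |x| := Real.one_le_exp (abs_nonneg x)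
  have h1 : x ^ 2 ≤ x ^ 2 * Real.exp |x| := le_mul_of_one_le_right (sq_nonneg x) h0
  rcases le_or_gt |x| 1 with h | h
  · have := (abs_le.1 (Real.abs_exp_sub_one_sub_id_le h)).2
    linarith
  · rcases lt_abs.1 h with h | h
    · rw [abs_of_pos (by linarith)]
      have : Real.exp x ≤ x ^ 2 * Real.exp x :=
        le_mul_of_one_le_left (Real.exp_pos x).le (by nlinarith)
      linarith
    · have : Real.exp x ≤ 1 := Real.exp_le_one_iff.2 (by linarith)
      nlinarith

lemma exp_mul_le_of_mem_unit {θ : ℝ} (h0 : 0 ≤ θ) (h1 : θ ≤ 1) (y : ℝ) :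
    Real.exp (θ * y) ≤ 1 - θ + θ * Real.exp y := by
  have := convexOn_exp.2 (Set.mem_univ 0) (Set.mem_univ y) (sub_nonneg.2 h1) h0 (by ring)
  simpa using this

/-- A centred variable with a square-exponential moment is subgaussian. -/
lemma lintegral_expE_mul_le {Ω : Type*} [MeasurableSpace Ω] {μ : Measure Ω}
    [IsProbabilityMeasure μ] {Z : Ω → ℝ} (hZ : Measurable Z) (hZi : Integrable Z μ)
    (hZ0 : ∫ ω, Z ω ∂μ = 0) {c : ℝ} (hc : 0 < c)
    (h : ∫⁻ ω, expE (c * Z ω ^ 2) ∂μ ≤ ENNReal.ofReal 2) (t : ℝ) :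
    ∫⁻ ω, expE (t * Z ω) ∂μ ≤ expE (c⁻¹ * t ^ 2) := by
  obtain ⟨gi, g2⟩ := integrable_exp_of_lintegral_expE_le (by fun_prop) (by norm_num) h
  -- For small `t`, the mean is at most `(1 - θ) + 2θ = 1 + θ ≤ exp θ` with `θ = t²/c`. For large
  -- `t`, centring is not needed: `tZ ≤ t²/(2c) + cZ²/2` costs a factor `3/2`, absorbed by
  -- `exp(t²/(2c))` because `t²/(2c) ≥ 1/2`.
  rcases le_or_gt (t ^ 2) c with htc | htc
  · set θ := c⁻¹ * t ^ 2 with hθ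
    have hθ0 : 0 ≤ θ := by positivity
    have hθ1 : θ ≤ 1 := by rw [hθ, inv_mul_le_iff₀ hc]; linarith
    have i1 : Integrable (fun ω => t * Z ω + (1 - θ)) μ := (hZi.const_mul t).add (integrable_const _)
    refine lintegral_expE_le_of_le (h := fun ω => t * Z ω + (1 - θ) + θ * Real.exp (c * Z ω ^ 2))
      (fun ω => ?_) (i1.add (gi.const_mul θ)) ?_
    · have h1 := exp_le_self_add_exp_sq (t * Z ω)
      have h2 := exp_mul_le_of_mem_unit hθ0 hθ1 (c * Z ω ^ 2)
      rw [show θ * (c * Z ω ^ 2) = (t * Z ω) ^ 2 by rw [hθ]; field_simp] at h2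
      linarith
    · rw [integral_add i1 (gi.const_mul θ), integral_add (hZi.const_mul t) (integrable_const _),
        integral_const_mul, integral_const_mul, hZ0]
      simp only [integral_const, probReal_univ, one_smul]
      nlinarith [Real.add_one_le_exp θ]
  · refine lintegral_expE_le_of_le
      (h := fun ω => Real.exp (t ^ 2 / (2 * c)) * (1 / 2 + 1 / 2 * Real.exp (c * Z ω ^ 2)))
      (fun ω => ?_) (((integrable_const _).add (gi.const_mul _)).const_mul _) ?_
    · have h2 := exp_mul_le_of_mem_unit (θ := 1 / 2) (by norm_num) (by norm_num) (c * Z ω ^ 2)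
      have h3 : t * Z ω ≤ t ^ 2 / (2 * c) + 1 / 2 * (c * Z ω ^ 2) := by
        have : t ^ 2 / (2 * c) + 1 / 2 * (c * Z ω ^ 2) - t * Z ω = (t - c * Z ω) ^ 2 / (2 * c) := by
          field_simp; ring
        have : 0 ≤ (t - c * Z ω) ^ 2 / (2 * c) := by positivity
        linarith
      refine (Real.exp_le_exp.2 h3).trans ?_
      rw [Real.exp_add]
      gcongr
      linarith
    · rw [integral_const_mul, integral_add (integrable_const _) (gi.const_mul _),
        integral_const_mul]
      simp only [integral_const, probReal_univ, one_smul]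
      have h4 : c⁻¹ * t ^ 2 = t ^ 2 / (2 * c) + t ^ 2 / (2 * c) := by field_simp; ring
      rw [h4, Real.exp_add]
      gcongr
      have h5 : 1 / 2 ≤ t ^ 2 / (2 * c) := by rw [div_le_div_iff₀ (by norm_num) (by positivity)]; linarith
      linarith [Real.add_one_le_exp (t ^ 2 / (2 * c))]

/-- The centred square of a variable with a square-exponential moment is subexponential. -/
lemma lintegral_expE_mul_sq_sub_one_le {Ω : Type*} [MeasurableSpace Ω] {μ : Measure Ω}
    [IsProbabilityMeasure μ] {Z : Ω → ℝ} (hZ : Measurable Z)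
    (hZ1 : ∫ ω, Z ω ^ 2 ∂μ = 1) {c : ℝ} (hc : 0 < c) (hc1 : c ≤ 1)
    (h : ∫⁻ ω, expE (c * Z ω ^ 2) ∂μ ≤ ENNReal.ofReal 2) {t : ℝ} (ht : |t| ≤ c / 2) :
    ∫⁻ ω, expE (t * (Z ω ^ 2 - 1)) ∂μ ≤ expE (48 / c ^ 2 * t ^ 2) := by
  obtain ⟨gi, g2⟩ := integrable_exp_of_lintegral_expE_le (by fun_prop) (by norm_num) h
  -- A non-integrable function has Bochner integral `0`, so a second moment equal to `1` forces
  -- integrability.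
  have hZi : Integrable (fun ω => Z ω ^ 2) μ := by
    by_contra hn
    rw [integral_undef hn] at hZ1
    exact zero_ne_one hZ1
  have i0 : Integrable (fun ω => Z ω ^ 2 - 1) μ := hZi.sub (integrable_const _)
  have i1 : Integrable (fun ω => 1 + t * (Z ω ^ 2 - 1)) μ := (integrable_const _).add (i0.const_mul t)
  refine lintegral_expE_le_of_le
    (h := fun ω => 1 + t * (Z ω ^ 2 - 1) + 24 / c ^ 2 * t ^ 2 * Real.exp (c * Z ω ^ 2))
    (fun ω => ?_) (i1.add (gi.const_mul _)) ?_
  -- The constant is `24 = 8 · 3`: `8` from `y²/2 ≤ exp y` at `y = c|Y|/2`, and `3 ≥ e` from `c|Y| ≤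
  -- 1 + cZ²`, where `c ≤ 1` enters.
  · set Y := Z ω ^ 2 - 1 with hY
    have h1 := exp_le_one_add_add_sq_mul_exp_abs (t * Y)
    have h2 : (c / 2 * |Y|) ^ 2 / 2 ≤ Real.exp (c / 2 * |Y|) := by
      have := Real.pow_div_factorial_le_exp (x := c / 2 * |Y|) (by positivity) 2
      simpa using this
    have h3 : Real.exp |t * Y| ≤ Real.exp (c / 2 * |Y|) := by
      rw [abs_mul]; gcongr
    have h4 : Real.exp (c / 2 * |Y|) * Real.exp (c / 2 * |Y|) ≤ 3 * Real.exp (c * Z ω ^ 2) := by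
      have h5 : |Y| ≤ 1 + Z ω ^ 2 := by
        rw [abs_le]; constructor <;> nlinarith [sq_nonneg (Z ω)]
      have h6 : Real.exp 1 ≤ 3 := by linarith [Real.exp_one_lt_d9]
      calc Real.exp (c / 2 * |Y|) * Real.exp (c / 2 * |Y|)
          = Real.exp (c * |Y|) := by rw [← Real.exp_add]; congr 1; ring
        _ ≤ Real.exp (1 + c * Z ω ^ 2) := by
            apply Real.exp_le_exp.2
            nlinarith [mul_le_mul_of_nonneg_left h5 hc.le]
        _ ≤ 3 * Real.exp (c * Z ω ^ 2) := by rw [Real.exp_add]; gcongr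
    have h7 : (t * Y) ^ 2 = 8 / c ^ 2 * t ^ 2 * ((c / 2 * |Y|) ^ 2 / 2) := by
      rw [mul_pow (c / 2), sq_abs]; field_simp; norm_num
    have h8 : (t * Y) ^ 2 * Real.exp |t * Y| ≤ 24 / c ^ 2 * t ^ 2 * Real.exp (c * Z ω ^ 2) := by
      calc (t * Y) ^ 2 * Real.exp |t * Y|
          ≤ (8 / c ^ 2 * t ^ 2 * Real.exp (c / 2 * |Y|)) * Real.exp (c / 2 * |Y|) := by
            rw [h7]; gcongr
        _ = 8 / c ^ 2 * t ^ 2 * (Real.exp (c / 2 * |Y|) * Real.exp (c / 2 * |Y|)) := by ring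
        _ ≤ 8 / c ^ 2 * t ^ 2 * (3 * Real.exp (c * Z ω ^ 2)) := by gcongr
        _ = _ := by ring
    linarith
  · rw [integral_add i1 (gi.const_mul _), integral_add (integrable_const _) (i0.const_mul t),
      integral_const_mul, integral_const_mul, integral_sub hZi (integrable_const _), hZ1]
    simp only [integral_const, probReal_univ, one_smul]
    have h9 : 24 / c ^ 2 * t ^ 2 * ∫ ω, Real.exp (c * Z ω ^ 2) ∂μ ≤ 24 / c ^ 2 * t ^ 2 * 2 := by gcongr
    have h10 := Real.add_one_le_exp (48 / c ^ 2 * t ^ 2)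
    have h11 : 24 / c ^ 2 * t ^ 2 * 2 = 48 / c ^ 2 * t ^ 2 := by ring
    linarith

/-- Exponential moments of a Bernoulli variable. -/
lemma lintegral_expE_mul_bernoulli_le {Ω : Type*} [MeasurableSpace Ω] {μ : Measure Ω}
    [IsProbabilityMeasure μ] {ξ : Ω → ℝ} (hξ : Measurable ξ) (h01 : ∀ ω, ξ ω = 0 ∨ ξ ω = 1)
    {p : ℝ} (hp : ∫ ω, ξ ω ∂μ = p) {t : ℝ} (ht : |t| ≤ 1) :
    ∫⁻ ω, expE (t * ξ ω) ∂μ ≤ expE (p * (t + t ^ 2)) := by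
  have hi : Integrable ξ μ := Integrable.of_bound (C := 1) hξ.aestronglyMeasurable
    (ae_of_all _ fun ω => by rcases h01 ω with h | h <;> simp [h])
  have hp0 : 0 ≤ p := hp ▸ integral_nonneg fun ω => by rcases h01 ω with h | h <;> simp [h]
  refine lintegral_expE_le_of_le (h := fun ω => 1 + (Real.exp t - 1) * ξ ω) (fun ω => ?_)
    ((integrable_const _).add (hi.const_mul _)) ?_
  · rcases h01 ω with h | h <;> simp [h]
  · rw [integral_add (integrable_const _) (hi.const_mul _), integral_const_mul, hp]
    simp only [integral_const, probReal_univ, one_smul]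
    have h1 := Real.add_one_le_exp (p * (t + t ^ 2))
    have h2 := (abs_le.1 (Real.abs_exp_sub_one_sub_id_le ht)).2
    nlinarith

/-! ### Hanson–Wright for positive semidefinite matrices -/

/-- Exponential moments of a centred positive semidefinite quadratic form of independent
variables with square-exponential moments (Hanson–Wright). -/
lemma lintegral_expE_quadForm_le {Ω : Type*} [MeasurableSpace Ω] {μ : Measure Ω}
    [IsProbabilityMeasure μ] {m : ℕ} {X : Fin m → Ω → ℝ} (hX : ∀ i, Measurable (X i))
    (hi : iIndepFun X μ) (hX0 : ∀ i, ∫ ω, X i ω ∂μ = 0) (hX1 : ∀ i, ∫ ω, X i ω ^ 2 ∂μ = 1)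
    {c : ℝ} (hc : 0 < c) (hc1 : c ≤ 1)
    (h : ∀ i, ∫⁻ ω, expE (c * X i ω ^ 2) ∂μ ≤ ENNReal.ofReal 2)
    {A : Matrix (Fin m) (Fin m) ℝ} (hA : A.IsSymm) {N : ℝ} (hN0 : 0 ≤ N)
    (hpos : ∀ x, 0 ≤ x ⬝ᵥ (A *ᵥ x)) (hN : ∀ x, x ⬝ᵥ (A *ᵥ x) ≤ N * (x ⬝ᵥ x))
    {t : ℝ} (ht : |t| * N ≤ c / 32) :
    ∫⁻ ω, expE (t * ((fun i => X i ω) ⬝ᵥ (A *ᵥ fun i => X i ω) - A.trace)) ∂μ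
      ≤ expE (256 / c ^ 2 * t ^ 2 * (N * A.trace)) := by
  have hdiag : ∀ i, 0 ≤ A i i ∧ A i i ≤ N := fun i => by
    have h1 := hpos (Pi.single i 1)
    have h2 := hN (Pi.single i 1)
    simp at h1 h2
    exact ⟨h1, h2⟩
  have htN : t ^ 2 * N ^ 2 ≤ c ^ 2 / 1024 := by
    have := pow_le_pow_left₀ (by positivity) ht 2
    rw [mul_pow, sq_abs] at this
    linarith
  have hXi : ∀ i, Integrable (X i) μ := by
    intro i
    have h1 : Integrable (fun ω => X i ω ^ 2) μ := by
      by_contra hn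
      have := hX1 i
      rw [integral_undef hn] at this
      exact zero_ne_one this
    exact ((memLp_two_iff_integrable_sq (hX i).aestronglyMeasurable).2 h1).integrable (by norm_num)
  have hsub : ∀ i u, ∫⁻ ω, expE (u * X i ω) ∂μ ≤ expE (c⁻¹ * u ^ 2) := fun i u =>
    lintegral_expE_mul_le (hX i) (hXi i) (hX0 i) hc (h i) u
  -- The parameter is `2t` because `expE_add_le` doubles it; hence `64 · (2t)² = 256 t²` in the
  -- bound.
  have hoff := lintegral_expE_offDiag_le hX hi (inv_nonneg.2 hc.le) hsub hA hpos hN (t := 2 * t) (by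
    have e : c⁻¹ ^ 2 * (4 * (2 * t)) ^ 2 * N ^ 2 = 64 / c ^ 2 * (t ^ 2 * N ^ 2) := by
      field_simp; ring
    rw [e]
    calc 64 / c ^ 2 * (t ^ 2 * N ^ 2) ≤ 64 / c ^ 2 * (c ^ 2 / 1024) := by gcongr
      _ ≤ 1 / 8 := by field_simp; norm_num)
  have hdia := lintegral_expE_sum_le hX hi (fun i x => 2 * t * A i i * (x ^ 2 - 1))
    (fun i => by fun_prop) (fun i => 48 / c ^ 2 * (2 * t * A i i) ^ 2) fun i =>
      lintegral_expE_mul_sq_sub_one_le (hX i) (hX1 i) hc hc1 (h i) (by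
        rw [abs_mul, abs_mul, abs_of_nonneg (hdiag i).1]
        have := mul_le_mul_of_nonneg_left (hdiag i).2 (abs_nonneg t)
        norm_num
        linarith)
  have hsplit : ∀ ω, t * ((fun i => X i ω) ⬝ᵥ (A *ᵥ fun i => X i ω) - A.trace)
      = t * ((fun i => X i ω) ⬝ᵥ (A *ᵥ fun i => X i ω) - ∑ i, A i i * X i ω ^ 2)
        + t * ∑ i, A i i * (X i ω ^ 2 - 1) := by
    intro ω
    simp only [mul_sub, Finset.sum_sub_distrib, Matrix.trace, Matrix.diag, mul_one]
    ring
  have hdia' : ∫⁻ ω, expE (2 * (t * ∑ i, A i i * (X i ω ^ 2 - 1))) ∂μ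
      ≤ expE (256 / c ^ 2 * t ^ 2 * (N * A.trace)) := by
    refine le_trans (le_of_eq ?_) (hdia.trans (expE_mono ?_))
    · refine lintegral_congr fun ω => ?_
      rw [← mul_assoc, Finset.mul_sum]
      simp only [mul_assoc]
    · rw [Matrix.trace, Finset.mul_sum, Finset.mul_sum]
      refine Finset.sum_le_sum fun i _ => ?_
      have h1 : A i i ^ 2 ≤ N * A i i := by nlinarith [hdiag i]
      have h2 : 0 ≤ N * A i i := mul_nonneg hN0 (hdiag i).1
      calc 48 / c ^ 2 * (2 * t * A i i) ^ 2 = 192 / c ^ 2 * t ^ 2 * A i i ^ 2 := by ring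
        _ ≤ 256 / c ^ 2 * t ^ 2 * (N * A i i) := by gcongr; norm_num
  have hoff' : ∫⁻ ω, expE (2 * (t * ((fun i => X i ω) ⬝ᵥ (A *ᵥ fun i => X i ω)
      - ∑ i, A i i * X i ω ^ 2))) ∂μ ≤ expE (256 / c ^ 2 * t ^ 2 * (N * A.trace)) := by
    simp only [← mul_assoc]
    refine hoff.trans_eq ?_
    congr 1
    field_simp
    ring
  have hm1 : Measurable fun ω => expE (2 * (t * ((fun i => X i ω) ⬝ᵥ (A *ᵥ fun i => X i ω)
      - ∑ i, A i i * X i ω ^ 2))) := by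
    simp only [dotProduct, Matrix.mulVec]; fun_prop
  simp_rw [hsplit]
  refine (lintegral_mono fun ω => expE_add_le _ _).trans ?_
  rw [lintegral_const_mul _ (by fun_prop), lintegral_add_left hm1]
  refine (mul_le_mul_right (add_le_add hoff' hdia') _).trans_eq ?_
  rw [← two_mul, ← mul_assoc, ENNReal.inv_mul_cancel (by norm_num) (by norm_num), one_mul]

/-! ### The sparse quadratic form -/

lemma opNorm_nonneg {m : ℕ} (B : Matrix (Fin m) (Fin m) ℝ) : 0 ≤ opNorm B := norm_nonneg _

lemma dotProduct_mulVec_le_opNorm {m : ℕ} (B : Matrix (Fin m) (Fin m) ℝ) (x : Fin m → ℝ) :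
    x ⬝ᵥ (B *ᵥ x) ≤ opNorm B * (x ⬝ᵥ x) := by
  have hin : ∀ y : Fin m → ℝ, inner ℝ (WithLp.toLp 2 x) (WithLp.toLp 2 y) = x ⬝ᵥ y := by
    intro y
    rw [EuclideanSpace.inner_eq_star_dotProduct, dotProduct_comm]; simp
  rw [← hin, ← hin, real_inner_self_eq_norm_sq]
  refine (real_inner_le_norm _ _).trans ?_
  have h := (Matrix.toEuclideanCLM (n := Fin m) (𝕜 := ℝ) B).le_opNorm (WithLp.toLp 2 x)
  rw [Matrix.toEuclideanCLM_toLp] at h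
  calc _ ≤ ‖WithLp.toLp 2 x‖ * (opNorm B * ‖WithLp.toLp 2 x‖) := by gcongr; exact h
    _ = _ := by ring

lemma trace_mul_diagonal_mul {m : ℕ} (D : Matrix (Fin m) (Fin m) ℝ) (z : Fin m → ℝ) :
    (D * Matrix.diagonal z * D).trace = ∑ k, (D ^ 2) k k * z k := by
  rw [Matrix.trace_mul_comm, ← mul_assoc, ← sq]
  simp [Matrix.trace, Matrix.mul_diagonal]

lemma sparseQuadForm_eq_sum {m : ℕ} {D : Matrix (Fin m) (Fin m) ℝ} (hD : D.IsSymm)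
    (z x : Fin m → ℝ) : sparseQuadForm D z x = ∑ k, z k * (D *ᵥ x) k ^ 2 := by
  rw [sparseQuadForm, mul_assoc, ← Matrix.mulVec_mulVec, Matrix.dotProduct_mulVec,
    ← Matrix.mulVec_transpose, hD.eq, ← Matrix.mulVec_mulVec]
  refine Finset.sum_congr rfl fun k _ => ?_
  rw [Matrix.mulVec_diagonal]; ring

lemma dotProduct_sq_mulVec {m : ℕ} {D : Matrix (Fin m) (Fin m) ℝ} (hD : D.IsSymm)
    (x : Fin m → ℝ) : x ⬝ᵥ ((D ^ 2) *ᵥ x) = ∑ k, (D *ᵥ x) k ^ 2 := by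
  have := sparseQuadForm_eq_sum hD (fun _ => 1) x
  simpa [sparseQuadForm, sq D] using this

lemma sq_apply_self_mem {m : ℕ} {D : Matrix (Fin m) (Fin m) ℝ} (hD : D.IsSymm) (k : Fin m) :
    0 ≤ (D ^ 2) k k ∧ (D ^ 2) k k ≤ opNorm (D ^ 2) := by
  have h1 := dotProduct_sq_mulVec hD (Pi.single k 1)
  have h2 := dotProduct_mulVec_le_opNorm (D ^ 2) (Pi.single k 1)
  have h3 : 0 ≤ ∑ j, (D *ᵥ Pi.single k 1) j ^ 2 := Finset.sum_nonneg fun j _ => sq_nonneg _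
  rw [← h1] at h3
  simp at h2 h3
  exact ⟨h3, h2⟩

/-- Exponential moments of the centred sparse quadratic form. -/
lemma lintegral_expE_sparseQuadForm_le {Ω : Type*} [MeasurableSpace Ω] {μ : Measure Ω}
    [IsProbabilityMeasure μ] {m : ℕ} {X ξ : Fin m → Ω → ℝ} (hX : ∀ i, Measurable (X i))
    (hξ : ∀ i, Measurable (ξ i)) (hi : iIndepFun X μ) (hiξ : iIndepFun ξ μ)
    (hXξ : IndepFun (fun ω i => X i ω) (fun ω i => ξ i ω) μ)
    (hX0 : ∀ i, ∫ ω, X i ω ∂μ = 0) (hX1 : ∀ i, ∫ ω, X i ω ^ 2 ∂μ = 1)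
    {c : ℝ} (hc : 0 < c) (hc1 : c ≤ 1)
    (h : ∀ i, ∫⁻ ω, expE (c * X i ω ^ 2) ∂μ ≤ ENNReal.ofReal 2)
    (h01 : ∀ i ω, ξ i ω = 0 ∨ ξ i ω = 1) {p : ℝ} (hp : 0 ≤ p) (hξp : ∀ i, ∫ ω, ξ i ω ∂μ = p)
    {D : Matrix (Fin m) (Fin m) ℝ} (hD : D.IsSymm)
    {t : ℝ} (ht : |t| * opNorm (D ^ 2) ≤ c ^ 2 / 256) :
    ∫⁻ ω, expE (t * (sparseQuadForm D (fun i => ξ i ω) (fun i => X i ω)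
        - p * (D ^ 2).trace)) ∂μ
      ≤ expE (260 / c ^ 2 * t ^ 2 * opNorm (D ^ 2) * (p * (D ^ 2).trace)) := by
  set N := opNorm (D ^ 2) with hNdef
  set T := p * (D ^ 2).trace with hT
  have hN0 : 0 ≤ N := opNorm_nonneg _
  -- `u` is the total coefficient of `tr A_ξ` after averaging over `X`: `t` from recentring at `T`,
  -- the rest from the Hanson–Wright bound.
  set u := t + 256 / c ^ 2 * t ^ 2 * N with hu
  have htc : |t| * N ≤ c / 32 := ht.trans (by nlinarith)
  have hu2 : |u| ≤ 2 * |t| := by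
    have h1 : |256 / c ^ 2 * t ^ 2 * N| = 256 / c ^ 2 * (|t| * N) * |t| := by
      rw [abs_of_nonneg (by positivity), ← sq_abs t]; ring
    have h2 : 256 / c ^ 2 * (|t| * N) * |t| ≤ 256 / c ^ 2 * (c ^ 2 / 256) * |t| := by gcongr
    have h3 : 256 / c ^ 2 * (c ^ 2 / 256) = 1 := by field_simp
    rw [h3, one_mul] at h2
    have := abs_add_le t (256 / c ^ 2 * t ^ 2 * N)
    linarith
  have hF : Measurable fun q : (Fin m → ℝ) × (Fin m → ℝ) =>
      expE (t * (sparseQuadForm D q.2 q.1 - T)) := by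
    simp_rw [sparseQuadForm_eq_sum hD]
    simp only [dotProduct, Matrix.mulVec]; fun_prop
  rw [hXξ.lintegral_eq_lintegral_lintegral (measurable_pi_lambda _ hX) (measurable_pi_lambda _ hξ) hF]
  have hinner : ∀ ω', ∫⁻ ω, expE (t * (sparseQuadForm D (fun i => ξ i ω') (fun i => X i ω) - T)) ∂μ
      ≤ expE (-(t * T)) * expE (∑ k, u * (D ^ 2) k k * ξ k ω') := by
    intro ω'
    set A := D * Matrix.diagonal (fun i => ξ i ω') * D with hA
    have hAsymm : A.IsSymm := by
      rw [Matrix.IsSymm, hA, Matrix.transpose_mul, Matrix.transpose_mul, hD.eq,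
        Matrix.diagonal_transpose, mul_assoc]
    have hξ0 : ∀ k, 0 ≤ ξ k ω' ∧ ξ k ω' ≤ 1 := fun k => by
      rcases h01 k ω' with h | h <;> simp [h]
    have hform : ∀ x, x ⬝ᵥ (A *ᵥ x) = ∑ k, ξ k ω' * (D *ᵥ x) k ^ 2 :=
      fun x => sparseQuadForm_eq_sum hD _ x
    have hpos : ∀ x, 0 ≤ x ⬝ᵥ (A *ᵥ x) := fun x => by
      rw [hform]; exact Finset.sum_nonneg fun k _ => mul_nonneg (hξ0 k).1 (sq_nonneg _)
    have hle : ∀ x, x ⬝ᵥ (A *ᵥ x) ≤ N * (x ⬝ᵥ x) := fun x => by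
      refine le_trans ?_ (dotProduct_mulVec_le_opNorm (D ^ 2) x)
      rw [hform, dotProduct_sq_mulVec hD]
      exact Finset.sum_le_sum fun k _ => mul_le_of_le_one_left (sq_nonneg _) (hξ0 k).2
    have hHW := lintegral_expE_quadForm_le hX hi hX0 hX1 hc hc1 h hAsymm hN0 hpos hle htc
    have hsplit : ∀ ω, expE (t * (sparseQuadForm D (fun i => ξ i ω') (fun i => X i ω) - T))
        = expE (t * (A.trace - T)) *
          expE (t * ((fun i => X i ω) ⬝ᵥ (A *ᵥ fun i => X i ω) - A.trace)) := by
      intro ω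
      rw [← expE_add]
      congr 1
      rw [sparseQuadForm]
      ring
    simp_rw [hsplit]
    rw [lintegral_const_mul' _ _ (expE_ne_top _)]
    refine (mul_le_mul_right hHW _).trans_eq ?_
    rw [← expE_add, ← expE_add]
    congr 1
    have : A.trace = ∑ k, (D ^ 2) k k * ξ k ω' := trace_mul_diagonal_mul D _
    simp only [mul_assoc u, ← Finset.mul_sum, ← this]
    rw [hu]; ring
  have hβ : ∀ k, |u * (D ^ 2) k k| ≤ 1 := fun k => by
    obtain ⟨h1, h2⟩ := sq_apply_self_mem hD k
    rw [abs_mul, abs_of_nonneg h1]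
    have h3 : |u| * (D ^ 2) k k ≤ 2 * |t| * N := by gcongr
    linarith
  refine (lintegral_mono hinner).trans ?_
  rw [lintegral_const_mul' _ _ (expE_ne_top _)]
  refine (mul_le_mul_right (lintegral_expE_sum_le hξ hiξ (fun k x => u * (D ^ 2) k k * x)
    (fun k => by fun_prop) _ fun k =>
      lintegral_expE_mul_bernoulli_le (hξ k) (h01 k) (hξp k) (hβ k)) _).trans ?_
  rw [← expE_add]
  apply expE_mono
  have hsum : ∑ k, p * (u * (D ^ 2) k k + (u * (D ^ 2) k k) ^ 2) ≤ (u + u ^ 2 * N) * T := by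
    rw [hT, Matrix.trace, ← mul_assoc, Finset.mul_sum]
    refine Finset.sum_le_sum fun k _ => ?_
    obtain ⟨h1, h2⟩ := sq_apply_self_mem hD k
    have h3 : (D ^ 2) k k ^ 2 ≤ N * (D ^ 2) k k := by nlinarith
    have h4 := mul_le_mul_of_nonneg_left h3 (mul_nonneg hp (sq_nonneg u))
    simp only [Matrix.diag]
    linarith
  have hT0 : 0 ≤ T := mul_nonneg hp (Finset.sum_nonneg fun k _ => (sq_apply_self_mem hD k).1)
  have hu3 : u ^ 2 ≤ 4 * t ^ 2 := by
    have := pow_le_pow_left₀ (abs_nonneg u) hu2 2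
    rw [mul_pow, sq_abs, sq_abs] at this
    linarith
  have hc2 : 4 ≤ 4 / c ^ 2 := by
    rw [le_div_iff₀ (by positivity)]
    nlinarith
  calc -(t * T) + ∑ k, p * (u * (D ^ 2) k k + (u * (D ^ 2) k k) ^ 2)
      ≤ -(t * T) + (u + u ^ 2 * N) * T := by linarith
    _ = (256 / c ^ 2 * t ^ 2 + u ^ 2) * (N * T) := by rw [hu]; ring
    -- The first-order terms in `t` have cancelled. The Bernoulli fluctuation contributes `u² ≤
    -- 4t²`, and `c ≤ 1` brings it to the common form, giving `260 = 256 + 4`.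
    _ ≤ (256 / c ^ 2 * t ^ 2 + 4 / c ^ 2 * t ^ 2) * (N * T) := by
        gcongr
        exact hu3.trans (by gcongr)
    _ = 260 / c ^ 2 * t ^ 2 * N * T := by ring

/-! ### Chernoff bounds and the conclusion -/

/-- The exponential Markov inequality. -/
lemma measureReal_ge_le_exp {Ω : Type*} [MeasurableSpace Ω] {μ : Measure Ω} {f : Ω → ℝ} {a b : ℝ}
    (h : ∫⁻ ω, expE (f ω) ∂μ ≤ expE a) (hf : Measurable f) :
    μ.real {ω | b ≤ f ω} ≤ Real.exp (a - b) := by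
  have h1 : μ {ω | b ≤ f ω} ≤ ENNReal.ofReal (Real.exp (a - b)) := by
    have h2 : {ω | b ≤ f ω} ⊆ {ω | expE b ≤ expE (f ω)} := fun ω hω => expE_mono hω
    refine (measure_mono h2).trans ((meas_ge_le_lintegral_div (by fun_prop) (expE_ne_zero b)
      (expE_ne_top b)).trans ?_)
    rw [Real.exp_sub, ENNReal.ofReal_div_of_pos (Real.exp_pos b)]
    exact ENNReal.div_le_div_right h _
  exact ENNReal.toReal_le_of_le_ofReal (Real.exp_pos _).le h1

/-- Two-sided deviation bound from a bound on exponential moments. -/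
lemma measureReal_abs_le_ge {Ω : Type*} [MeasurableSpace Ω] {μ : Measure Ω}
    [IsProbabilityMeasure μ] {f : Ω → ℝ} (hf : Measurable f) {t a b : ℝ} (ht : 0 < t)
    (h1 : ∫⁻ ω, expE (t * f ω) ∂μ ≤ expE a) (h2 : ∫⁻ ω, expE (-t * f ω) ∂μ ≤ expE a) :
    1 - 2 * Real.exp (a - t * b) ≤ μ.real {ω | |f ω| ≤ b} := by
  have hm : MeasurableSet {ω | |f ω| ≤ b} := measurableSet_le (by fun_prop) measurable_const
  have hc := probReal_compl_eq_one_sub (μ := μ) hm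
  have hsub : {ω | |f ω| ≤ b}ᶜ ⊆ {ω | t * b ≤ t * f ω} ∪ {ω | t * b ≤ -t * f ω} := by
    intro ω hω
    simp only [Set.mem_compl_iff, Set.mem_ofPred_eq, not_le] at hω
    rcases lt_abs.1 hω with h | h
    · exact Or.inl (mul_le_mul_of_nonneg_left h.le ht.le)
    · refine Or.inr ?_
      have := mul_le_mul_of_nonneg_left h.le ht.le
      simp only [Set.mem_ofPred_eq]
      linarith
  have h3 := (measureReal_mono (μ := μ) hsub).trans (measureReal_union_le _ _)
  have h4 := measureReal_ge_le_exp (b := t * b) h1 (by fun_prop)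
  have h5 := measureReal_ge_le_exp (b := t * b) h2 (by fun_prop)
  linarith

theorem mainTheorem6
    (K : ℝ)
    (D : (m : ℕ) → Matrix (Fin m) (Fin m) ℝ) (hD : ∀ m, (D m).IsSymm)
    (p : ℕ → ℝ) (hp : ∀ m, 0 ≤ p m ∧ p m ≤ 1)
    (hrate : (fun m : ℕ => Real.log (m : ℝ) * opNorm (D m ^ 2))
      =o[atTop] (fun m : ℕ => p m * (D m ^ 2).trace)) :
    ∃ ε : ℕ → ℝ, Tendsto ε atTop (𝓝 0) ∧
      ∀ m : ℕ, 1 ≤ m →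
      ∀ (Ω : Type*) [MeasurableSpace Ω] (μ : Measure Ω) [IsProbabilityMeasure μ]
        (X ξ : Fin m → Ω → ℝ),
        (∀ i, Measurable (X i)) → (∀ i, Measurable (ξ i)) →
        iIndepFun X μ → iIndepFun ξ μ →
        IndepFun (fun ω i => X i ω) (fun ω i => ξ i ω) μ →
        (∀ i, ∫ ω, X i ω ∂μ = 0) →
        (∀ i, ∫ ω, (X i ω) ^ 2 ∂μ = 1) →
        (∀ i, psi2Norm μ (X i) ≤ ENNReal.ofReal K) →
        (∀ i ω, ξ i ω = 0 ∨ ξ i ω = 1) →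
        (∀ i, ∫ ω, ξ i ω ∂μ = p m) →
        1 - 4 / (m : ℝ) ^ 4 ≤
          μ.real {ω | |sparseQuadForm (D m) (fun i => ξ i ω) (fun i => X i ω)
              - p m * (D m ^ 2).trace| ≤ ε m * (p m * (D m ^ 2).trace)} := by
  -- Replacing `K` by `max K 1` weakens the moment hypothesis harmlessly and ensures `0 < c ≤ 1`.
  set c := (4 * Real.exp 1 * (max K 1) ^ 2)⁻¹ with hc
  have hK1 : 1 ≤ max K 1 := le_max_right _ _
  have he : 1 ≤ Real.exp 1 := Real.one_le_exp zero_le_one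
  have hc0 : 0 < c := by positivity
  have hc1 : c ≤ 1 := by
    refine inv_le_one_of_one_le₀ ?_
    have := one_le_pow₀ hK1 (n := 2)
    nlinarith
  set η : ℕ → ℝ := fun m => Real.log m * opNorm (D m ^ 2) / (p m * (D m ^ 2).trace) with hη
  have hη0 : Tendsto η atTop (𝓝 0) := hrate.tendsto_div_nhds_zero
  set κ := c ^ 2 / 256 with hκ
  have hκ0 : 0 < κ := by positivity
  -- `√η` balances the two terms of `ε`. The cap `κ` keeps `t = r/N` in the admissible range for
  -- every `m`, and is eventually inactive.
  set r : ℕ → ℝ := fun m => min √(η m) κ with hr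
  refine ⟨fun m => 260 / c ^ 2 * r m + 4 * (η m / r m), ?_, ?_⟩
  · have hs : Tendsto (fun m => √(η m)) atTop (𝓝 0) := by
      simpa [Function.comp_def] using (Real.continuous_sqrt.tendsto 0).comp hη0
    have h1 : Tendsto (fun m => 260 / c ^ 2 * √(η m) + 4 * √(η m)) atTop (𝓝 0) := by
      simpa using (hs.const_mul (260 / c ^ 2)).add (hs.const_mul 4)
    refine h1.congr' ?_
    filter_upwards [hs.eventually (gt_mem_nhds hκ0)] with m hm
    simp only [hr, min_eq_left hm.le, Real.div_sqrt]
  intro m hm Ω _ μ _ X ξ hX hξ hi hiξ hXξ hX0 hX1 hψ h01 hξp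
  have hsq : ∀ i, ∫⁻ ω, expE (c * X i ω ^ 2) ∂μ ≤ ENNReal.ofReal 2 := fun i =>
    lintegral_expE_sq_le_of_psi2Norm_le (hX i) (by linarith)
      ((hψ i).trans (ENNReal.ofReal_le_ofReal (le_max_left _ _)))
  set N := opNorm (D m ^ 2) with hN
  set T := p m * (D m ^ 2).trace with hT
  set Q : Ω → ℝ := fun ω => sparseQuadForm (D m) (fun i => ξ i ω) (fun i => X i ω) with hQ
  have hQm : Measurable Q := by
    simp only [hQ, sparseQuadForm_eq_sum (hD m), dotProduct, Matrix.mulVec]; fun_prop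
  have hN0 : 0 ≤ N := opNorm_nonneg _
  have htr0 : ∀ k, 0 ≤ (D m ^ 2) k k := fun k => (sq_apply_self_mem (hD m) k).1
  have hT0 : 0 ≤ T := mul_nonneg (hp m).1 (Finset.sum_nonneg fun k _ => htr0 k)
  have hm0 : (0 : ℝ) < m := by exact_mod_cast hm
  rcases hT0.eq_or_lt with hTz | hTpos
  -- If `T = 0`, the allowed deviation is `0` whatever `ε` is, so the form must vanish almost
  -- surely: either `p = 0` and all `ξ` vanish, or `tr D² = 0`, which is the sum of the squared
  -- entries of `D`.
  · have hzero : ∀ᵐ ω ∂μ, Q ω = 0 := by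
      rcases mul_eq_zero.1 hTz.symm with hpz | htz
      · have hξz : ∀ᵐ ω ∂μ, ∀ i, ξ i ω = 0 := by
          rw [ae_all_iff]
          intro i
          have hint : Integrable (ξ i) μ := Integrable.of_bound (C := 1) (hξ i).aestronglyMeasurable
            (ae_of_all _ fun ω => by rcases h01 i ω with h | h <;> simp [h])
          exact (integral_eq_zero_iff_of_nonneg
            (fun ω => by rcases h01 i ω with h | h <;> simp [h]) hint).1 ((hξp i).trans hpz)
        filter_upwards [hξz] with ω hω
        simp [hQ, sparseQuadForm_eq_sum (hD m), hω]
      · have hdz : ∀ k, (D m ^ 2) k k = 0 := fun k =>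
          (Finset.sum_eq_zero_iff_of_nonneg fun k _ => htr0 k).1 htz k (Finset.mem_univ k)
        have hDz : D m = 0 := by
          ext i j
          have h1 := hdz j
          rw [sq, Matrix.mul_apply] at h1
          have h2 := (Finset.sum_eq_zero_iff_of_nonneg fun k _ => by
            rw [(hD m).apply k j]; exact mul_self_nonneg _).1 h1 i (Finset.mem_univ i)
          rw [(hD m).apply i j] at h2
          simpa using h2
        exact ae_of_all _ fun ω => by simp [hQ, sparseQuadForm, hDz]
    have hone : μ.real {ω | |Q ω - T| ≤ (260 / c ^ 2 * r m + 4 * (η m / r m)) * T} = 1 := by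
      rw [measureReal_def, (prob_compl_eq_zero_iff₀ ?_).1, ENNReal.toReal_one]
      · rw [← hTz]
        filter_upwards [hzero] with ω hω
        simp [hω]
      · exact (measurableSet_le (by fun_prop) measurable_const).nullMeasurableSet
    rw [hone]
    have : 0 ≤ 4 / (m : ℝ) ^ 4 := by positivity
    linarith
  -- At `m = 1` the claimed lower bound is `-3`; excluding it makes `log m`, hence `η` and `r`,
  -- positive.
  rcases hm.eq_or_lt with rfl | hm2
  · refine le_trans ?_ measureReal_nonneg
    norm_num
  have hL : 0 < Real.log m := Real.log_pos (by exact_mod_cast hm2)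
  have hNpos : 0 < N := by
    refine lt_of_le_of_ne hN0 fun hNz => hTpos.ne' ?_
    have : (D m ^ 2).trace = 0 := Finset.sum_eq_zero fun k _ =>
      le_antisymm ((sq_apply_self_mem (hD m) k).2.trans_eq hNz.symm) (htr0 k)
    rw [hT, this, mul_zero]
  have hηpos : 0 < η m := by positivity
  have hrpos : 0 < r m := lt_min (Real.sqrt_pos.2 hηpos) hκ0
  have hrκ : r m ≤ κ := min_le_right _ _
  have ht : 0 < r m / N := by positivity
  have hbnd : |r m / N| * N ≤ κ := by rw [abs_of_pos ht, div_mul_cancel₀ _ hNpos.ne']; exact hrκ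
  have hM := fun t ht => lintegral_expE_sparseQuadForm_le hX hξ hi hiξ hXξ hX0 hX1 hc0 hc1 hsq h01
    (hp m).1 hξp (hD m) (t := t) ht
  have h1 := hM (r m / N) hbnd
  have h2 := hM (-(r m / N)) (by rwa [abs_neg])
  rw [neg_sq] at h2
  refine le_trans ?_ (measureReal_abs_le_ge (hQm.sub_const T) ht h1 h2)
  -- The `r²` terms cancel by the choice of `ε`, leaving `-4 η T / N = -4 log m`. The failure
  -- probability is thus at most `2/m⁴`.
  have hexp : 260 / c ^ 2 * (r m / N) ^ 2 * N * T
      - r m / N * ((260 / c ^ 2 * r m + 4 * (η m / r m)) * T) = -(Real.log m * (4 : ℕ)) := by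
    have hηm : η m = Real.log m * N / T := rfl
    rw [hηm]
    have := hTpos.ne'
    field_simp
    push_cast
    ring
  rw [hexp, Real.exp_neg, mul_comm (Real.log m), Real.exp_nat_mul, Real.exp_log hm0]
  have : 0 < ((m : ℝ) ^ 4)⁻¹ := by positivity
  rw [div_eq_mul_inv]
  linarith
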